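/- Let $\mathbb D$ be the open unit disk of $\mathbb C$. For $\alpha>-1$ let $\mathcal A^2_\alpha$ be the space of holomorphic functions $f$ on $\mathbb D$ with $$\|f\|_{\alpha,2}^2=\frac{1+\alpha}{\pi}\int_{\mathbb D}|f(z)|^2(1-|z|^2)^\alpha\,dx\,dy<\infty\qquad(z=x+iy).$$ For $\lambda\in\mathbb D$ and $0<r<1$ let $D(\lambda,r)=\left\{z\in\mathbb D:\left|\frac{\lambda-z}{1-\overline\lambda z}\right|<r\right\}$ be the pseudohyperbolic disk. A divisor is a set $X=\{(\lambda,m_\lambda)\}_{\lambda\in\Lambda}$, where $\Lambda\subset\mathbb D$ and each multiplicity $m_\lambda$ is a positive integer; $X$ is a uniqueness divisor for $\mathcal A^2_\alpha$ if the only $f\in\mathcal A^2_\alpha$ with $f^{(j)}(\lambda)=0$ for all $\lambda\in\Lambda$ and $0\le j<m_\lambda$ is $f=0$. **Theorem 1.3.** Let $\alpha>0$, $\varepsilon>0$, and let $X=\{(\lambda,m_\lambda)\}_{\lambda\in\Lambda}$ be a divisor such that $$\bigcup_{\lambda\in\Lambda}D\left(\lambda,\sqrt{\frac{m_\lambda}{m_\lambda+\alpha+2+\varepsilon}}\right)=\mathbb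 D\setminus K$$ for some compact set $K\subset\mathbb D$. Then $X$ is a uniqueness divisor for $\mathcal A^2_\alpha$. -/

import Mathlib

open MeasureTheory

noncomputable section

namespace BergmanDivisor

/-- The open unit disk, as a set of complex numbers. -/
def disk : Set ℂ := Metric.ball (0 : ℂ) 1

/-- The measure `dA_α(z) = (1 + α) (1 - |z|²)^α dx dy / π` on the unit disk. -/
def weightedArea (α : ℝ) : Measure ℂ :=
  (volume.restrict disk).withDensity fun z =>
    ENNReal.ofReal ((1 + α) * (1 - ‖z‖ ^ 2) ^ α / Real.pi)

/-- The weighted Bergman space `A²_α`: functions holomorphic on the unit disk which are square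
integrable for `dA_α`. A function on the disk is represented by a function on `ℂ` whose values
outside the disk play no role. -/
def bergman (α : ℝ) : Set (ℂ → ℂ) :=
  {f | DifferentiableOn ℂ f disk ∧ ∫⁻ z, ‖f z‖ₑ ^ 2 ∂(weightedArea α) < ⊤}

/-- The Möbius transform `φ_w(z) = (w - z) / (1 - w̄ z)`. -/
def mobius (w z : ℂ) : ℂ := (w - z) / (1 - (starRingEnd ℂ) w * z)

/-- The pseudohyperbolic distance on the unit disk. -/
def pseudoDist (u v : ℂ) : ℝ := ‖mobius u v‖

/-- The (open) pseudohyperbolic disk `D(w, r)`. -/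
def pseudoDisk (w : ℂ) (r : ℝ) : Set ℂ := {z | z ∈ disk ∧ pseudoDist w z < r}

/-- A divisor on the unit disk: a set of points of the disk, each with a multiplicity. -/
structure Divisor where
  points : Set ℂ
  points_subset : points ⊆ disk
  mult : points → ℕ
  mult_pos : ∀ w, 0 < mult w

/-- `f` vanishes on the divisor `X`: at each point `w` of `X`, the derivatives of `f` of order
`0, …, m_w - 1` vanish. -/
def VanishesOn (f : ℂ → ℂ) (X : Divisor) : Prop :=
  ∀ w : X.points, ∀ j < X.mult w, iteratedDeriv j f (w : ℂ) = 0

/-- `X` is a uniqueness divisor for the function space `F` on the disk: the only function of `F`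
which vanishes on `X` is the zero function. -/
def IsUniquenessDivisor (X : Divisor) (F : Set (ℂ → ℂ)) : Prop :=
  ∀ f ∈ F, VanishesOn f X → ∀ z ∈ disk, f z = 0

end BergmanDivisor

end

namespace BergmanDivisor

open Metric Set Filter Topology

/-! ### Pointwise growth of functions in the Bergman space -/

/-! Put β = α + 2 + ε. The mean value property gives |f|²(1 - |z|²)^(α+2) ≤ C, so the extra ε makes
|h|²(1 - |z|²)^β tend to 0 at the boundary for h = z^N f; if f ≠ 0 this weight attains a positive
maximum. For N large the maximum point avoids K, hence lies in one of the covering disks D(w,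
√(m/(m+β))).

This is impossible (`eq_zero_of_isMaxOn_of_mem_pseudoDisk`): composed with the Möbius map of w, the
weight becomes a constant times |G|² |ζ|^(2m) (1 - |ζ|²)^β with G holomorphic. The radial factor
increases strictly up to |ζ|² = m/(m+β), so the maximum principle for G gives a larger value on that
circle. -/

/-- A holomorphic function is dominated at the centre of a circle by its mean modulus there. -/
lemma two_pi_mul_enorm_le_lintegral_circle {h : ℂ → ℂ} {c : ℂ} {R t : ℝ}
    (hh : DifferentiableOn ℂ h (ball c R)) (ht0 : 0 < t) (htR : t < R) :
    ENNReal.ofReal (2 * Real.pi) * ‖h c‖ₑ ≤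
      ∫⁻ θ in Ioo (-Real.pi) Real.pi, ‖h (c + Complex.polarCoord.symm (t, θ))‖ₑ := by
  have hd : DiffContOnCl ℂ h (ball c |t|) := by
    rw [abs_of_pos ht0]
    exact (hh.mono (closedBall_subset_ball htR)).diffContOnCl_ball subset_rfl
  have hcm : ∀ θ : ℝ, circleMap c t θ = c + Complex.polarCoord.symm (t, θ) := fun θ ↦ by
    simp [circleMap, Complex.exp_mul_I]
  have hper : Function.Periodic (fun θ ↦ h (circleMap c t θ)) (2 * Real.pi) := fun θ ↦ by
    simp only [periodic_circleMap c t θ]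
  have h1 := hd.circleAverage
  rw [Real.circleAverage_def] at h1
  have h2 : (∫ θ in (0)..2 * Real.pi, h (circleMap c t θ)) =
      ∫ θ in (-Real.pi)..Real.pi, h (circleMap c t θ) := by
    have := hper.intervalIntegral_add_eq 0 (-Real.pi)
    rwa [zero_add, show -Real.pi + 2 * Real.pi = Real.pi by ring] at this
  rw [h2] at h1
  have h3 : (2 * Real.pi) • h c = ∫ θ in (-Real.pi)..Real.pi, h (circleMap c t θ) := by
    rw [← h1, smul_smul, mul_inv_cancel₀ (by positivity), one_smul]
  rw [intervalIntegral.integral_of_le (by linarith [Real.pi_pos]),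
    integral_Ioc_eq_integral_Ioo] at h3
  calc ENNReal.ofReal (2 * Real.pi) * ‖h c‖ₑ = ‖(2 * Real.pi) • h c‖ₑ := by
        rw [enorm_smul, Real.enorm_of_nonneg (by positivity)]
    _ ≤ ∫⁻ θ in Ioo (-Real.pi) Real.pi, ‖h (circleMap c t θ)‖ₑ := by
        rw [h3]; exact enorm_integral_le_lintegral_enorm _
    _ = _ := by simp only [hcm]

/-- A holomorphic function is dominated at the centre of a disk by its integral over the disk. -/
lemma ofReal_mul_enorm_le_lintegral_ball {h : ℂ → ℂ} {c : ℂ} {R : ℝ} (hR : 0 < R)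
    (hh : DifferentiableOn ℂ h (ball c R)) :
    ENNReal.ofReal (Real.pi * R ^ 2 / 2) * ‖h c‖ₑ ≤ ∫⁻ w in ball c R, ‖h w‖ₑ := by
  set k : ℂ → ENNReal := (ball c R).indicator fun w ↦ ‖h w‖ₑ with hk
  have hkm : Measurable k := by
    classical
    have : Measurable ((ball c R).piecewise (fun w ↦ ‖h w‖ₑ) fun _ ↦ 0) :=
      hh.continuousOn.enorm.measurable_piecewise continuousOn_const measurableSet_ball
    rw [hk, ← Set.piecewise_eq_indicator]
    exact this
  have hpm : Measurable fun p : ℝ × ℝ ↦ k (c + Complex.polarCoord.symm p) := by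
    refine hkm.comp ?_
    simp only [Complex.polarCoord_symm_apply]
    fun_prop
  -- Radii below R/2 are discarded so that the Jacobian t is at least R/2; this costs the factor 1/2
  -- in the constant.
  have hcirc : ∀ t ∈ Ioo (R / 2) R, ENNReal.ofReal (Real.pi * R) * ‖h c‖ₑ ≤
      ∫⁻ θ in Ioo (-Real.pi) Real.pi,
        ENNReal.ofReal t * k (c + Complex.polarCoord.symm (t, θ)) := by
    rintro t ⟨ht1, ht2⟩
    have ht0 : 0 < t := by linarith
    have hkt : ∀ θ, k (c + Complex.polarCoord.symm (t, θ)) =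
        ‖h (c + Complex.polarCoord.symm (t, θ))‖ₑ := fun θ ↦ by
      refine indicator_of_mem ?_ _
      rw [mem_ball, dist_self_add_left, Complex.norm_polarCoord_symm, abs_of_pos ht0]
      exact ht2
    simp only [hkt]
    rw [lintegral_const_mul' _ _ ENNReal.ofReal_ne_top]
    calc ENNReal.ofReal (Real.pi * R) * ‖h c‖ₑ
        ≤ ENNReal.ofReal (t * (2 * Real.pi)) * ‖h c‖ₑ := by
          gcongr ENNReal.ofReal ?_ * _; nlinarith [Real.pi_pos]
      _ = ENNReal.ofReal t * (ENNReal.ofReal (2 * Real.pi) * ‖h c‖ₑ) := by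
          rw [ENNReal.ofReal_mul ht0.le, mul_assoc]
      _ ≤ _ := by gcongr; exact two_pi_mul_enorm_le_lintegral_circle hh ht0 ht2
  calc ENNReal.ofReal (Real.pi * R ^ 2 / 2) * ‖h c‖ₑ
      = ∫⁻ _t in Ioo (R / 2) R, ENNReal.ofReal (Real.pi * R) * ‖h c‖ₑ := by
        rw [setLIntegral_const, Real.volume_Ioo, mul_right_comm,
          ← ENNReal.ofReal_mul (by positivity)]
        congr 2; ring
    _ ≤ ∫⁻ t in Ioo (R / 2) R, ∫⁻ θ in Ioo (-Real.pi) Real.pi,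
          ENNReal.ofReal t * k (c + Complex.polarCoord.symm (t, θ)) :=
        setLIntegral_mono' measurableSet_Ioo hcirc
    _ ≤ ∫⁻ t in Ioi 0, ∫⁻ θ in Ioo (-Real.pi) Real.pi,
          ENNReal.ofReal t * k (c + Complex.polarCoord.symm (t, θ)) :=
        lintegral_mono_set fun t ht ↦ lt_trans (by positivity) ht.1
    _ = ∫⁻ p in Ioi (0 : ℝ) ×ˢ Ioo (-Real.pi) Real.pi,
          ENNReal.ofReal p.1 * k (c + Complex.polarCoord.symm p) := by
        rw [Measure.volume_eq_prod, ← Measure.prod_restrict, lintegral_prod]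
        exact ((ENNReal.measurable_ofReal.comp measurable_fst).mul hpm).aemeasurable
    _ = ∫⁻ u, k (c + u) := Complex.lintegral_comp_polarCoord_symm fun u ↦ k (c + u)
    _ = ∫⁻ w, k w := lintegral_add_left_eq_self k c
    _ = _ := lintegral_indicator measurableSet_ball _

lemma one_sub_norm_sq_pos {z : ℂ} (hz : z ∈ disk) : 0 < 1 - ‖z‖ ^ 2 := by
  have : ‖z‖ < 1 := by simpa [disk] using hz
  nlinarith [norm_nonneg z]

/-- Within half the distance from z to the unit circle, 1 - |w|² ≥ 1 - |w| ≥ (1 - |z|)/2, and t ↦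
t^α is increasing. -/
lemma smul_volume_restrict_le_weightedArea {α : ℝ} (hα : 0 < α) {z : ℂ} (hz : z ∈ disk) :
    ENNReal.ofReal ((1 + α) * ((1 - ‖z‖) / 2) ^ α / Real.pi) •
      volume.restrict (ball z ((1 - ‖z‖) / 2)) ≤ weightedArea α := by
  have hz1 : ‖z‖ < 1 := by simpa [disk] using hz
  have hnorm : ∀ w ∈ ball z ((1 - ‖z‖) / 2), ‖w‖ < (1 + ‖z‖) / 2 := fun w hw ↦ by
    rw [mem_ball, dist_eq_norm] at hw
    have := norm_le_norm_add_norm_sub' w z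
    linarith
  have hsub : ball z ((1 - ‖z‖) / 2) ⊆ disk := fun w hw ↦ by
    rw [disk, mem_ball_zero_iff]
    linarith [hnorm w hw]
  unfold weightedArea
  calc _ = (volume.restrict (ball z ((1 - ‖z‖) / 2))).withDensity fun _ ↦
        ENNReal.ofReal ((1 + α) * ((1 - ‖z‖) / 2) ^ α / Real.pi) := (withDensity_const _).symm
    _ ≤ (volume.restrict (ball z ((1 - ‖z‖) / 2))).withDensity fun w ↦
        ENNReal.ofReal ((1 + α) * (1 - ‖w‖ ^ 2) ^ α / Real.pi) := by
      refine withDensity_mono ?_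
      filter_upwards [ae_restrict_mem measurableSet_ball] with w hw
      have := hnorm w hw
      gcongr
      nlinarith [norm_nonneg w]
    _ ≤ _ := by
      rw [← restrict_withDensity measurableSet_ball,
        ← restrict_withDensity (s := disk) measurableSet_ball]
      exact Measure.restrict_mono hsub le_rfl

/-- Apply the area estimate to f² on a ball of radius R = (1 - |z|)/2: the weight contributes R^α
and the area R². The factor 4^(α+2) comes from 1 - |z|² ≤ 4R. -/
theorem exists_sq_norm_mul_rpow_le_of_mem_bergman {α : ℝ} (hα : 0 < α) {f : ℂ → ℂ}
    (hf : f ∈ bergman α) :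
    ∃ C : ℝ, ∀ z ∈ disk, ‖f z‖ ^ 2 * (1 - ‖z‖ ^ 2) ^ (α + 2) ≤ C := by
  obtain ⟨hd, hfin⟩ := hf
  set M := ∫⁻ z, ‖f z‖ₑ ^ 2 ∂(weightedArea α) with hM
  refine ⟨4 ^ (α + 2) * (2 * M.toReal / (1 + α)), fun z hz ↦ ?_⟩
  have hz1 : ‖z‖ < 1 := by simpa [disk] using hz
  set R := (1 - ‖z‖) / 2 with hR
  have hR0 : 0 < R := by rw [hR]; linarith
  have hsub : ball z R ⊆ disk := fun w hw ↦ by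
    rw [mem_ball, dist_eq_norm] at hw
    rw [disk, mem_ball_zero_iff]
    have := norm_le_norm_add_norm_sub' w z
    linarith
  have hmean := ofReal_mul_enorm_le_lintegral_ball hR0 ((hd.mono hsub).pow 2)
  have hle : ENNReal.ofReal ((1 + α) * R ^ α / Real.pi) *
      ∫⁻ w in ball z R, ‖f w‖ₑ ^ 2 ≤ M := by
    rw [← smul_eq_mul, ← lintegral_smul_measure]
    exact lintegral_mono' (smul_volume_restrict_le_weightedArea hα hz) le_rfl
  have hkey : (1 + α) * R ^ α / Real.pi * (Real.pi * R ^ 2 / 2) * ‖f z‖ ^ 2 ≤ M.toReal := by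
    rw [← ENNReal.ofReal_le_iff_le_toReal hfin.ne, ENNReal.ofReal_mul (by positivity),
      ENNReal.ofReal_mul (by positivity), ENNReal.ofReal_pow (norm_nonneg _),
      ofReal_norm, mul_assoc]
    refine le_trans ?_ hle
    gcongr
    simpa [enorm_pow] using hmean
  have hkey' : ‖f z‖ ^ 2 * R ^ (α + 2) ≤ 2 * M.toReal / (1 + α) := by
    rw [le_div_iff₀ (by positivity), Real.rpow_add hR0, Real.rpow_two]
    have : (1 + α) * R ^ α / Real.pi * (Real.pi * R ^ 2 / 2) * ‖f z‖ ^ 2 =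
        ‖f z‖ ^ 2 * (R ^ α * R ^ 2) * (1 + α) / 2 := by
      field_simp
    linarith
  calc ‖f z‖ ^ 2 * (1 - ‖z‖ ^ 2) ^ (α + 2) ≤ ‖f z‖ ^ 2 * (4 * R) ^ (α + 2) := by
        have := (one_sub_norm_sq_pos hz).le
        gcongr
        nlinarith [norm_nonneg z]
    _ = 4 ^ (α + 2) * (‖f z‖ ^ 2 * R ^ (α + 2)) := by
        rw [Real.mul_rpow (by norm_num) hR0.le]; ring
    _ ≤ _ := by gcongr

/-! ### Factoring out zeros -/

theorem exists_eq_pow_mul_of_iteratedDeriv_eq_zero {f : ℂ → ℂ} {U : Set ℂ} (hU : IsOpen U)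
    (hf : DifferentiableOn ℂ f U) {w : ℂ} (hw : w ∈ U) {m : ℕ}
    (hm : ∀ j < m, iteratedDeriv j f w = 0) :
    ∃ g : ℂ → ℂ, DifferentiableOn ℂ g U ∧ ∀ z ∈ U, f z = (z - w) ^ m * g z := by
  have hfa : AnalyticAt ℂ f w := hf.analyticAt (hU.mem_nhds hw)
  obtain ⟨p, hpa, hp⟩ := (natCast_le_analyticOrderAt hfa).1
    ((natCast_le_analyticOrderAt_iff_iteratedDeriv_eq_zero hfa).2 hm)
  classical
  let g : ℂ → ℂ := fun z ↦ if z = w then p w else f z / (z - w) ^ m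
  have hgw : g =ᶠ[𝓝 w] p := by
    filter_upwards [hp] with z hz
    rcases eq_or_ne z w with rfl | hzw
    · simp [g]
    · have : (z - w) ^ m ≠ 0 := pow_ne_zero _ (sub_ne_zero.2 hzw)
      simp [g, hzw, hz, this]
  refine ⟨g, fun z hz ↦ ?_, fun z _ ↦ ?_⟩
  · rcases eq_or_ne z w with rfl | hzw
    · exact (hgw.differentiableAt_iff.2 hpa.differentiableAt).differentiableWithinAt
    · have hgz : g =ᶠ[𝓝 z] fun z ↦ f z / (z - w) ^ m := by
        filter_upwards [isOpen_ne.mem_nhds hzw] with y hy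
        exact if_neg hy
      refine (hgz.differentiableAt_iff.2 ?_).differentiableWithinAt
      exact (hf.differentiableAt (hU.mem_nhds hz)).div (by fun_prop)
        (pow_ne_zero _ (sub_ne_zero.2 hzw))
  · rcases eq_or_ne z w with rfl | hzw
    · simpa [g] using hp.self_of_nhds
    · have : (z - w) ^ m ≠ 0 := pow_ne_zero _ (sub_ne_zero.2 hzw)
      simp only [g, if_neg hzw]
      field_simp

/-! ### The maximum principle on pseudohyperbolic disks -/

/-- x is the critical point of m log s + β log(1 - s). Tangent-line bounds for both logarithms
suffice, since their linear terms cancel at x. -/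
lemma pow_mul_rpow_lt {m : ℕ} {β s x : ℝ} (hm : 0 < m) (hβ : 0 < β) (hs : 0 < s)
    (hx : x = m / (m + β)) (hsx : s < x) :
    s ^ m * (1 - s) ^ β < x ^ m * (1 - x) ^ β := by
  have hm' : (0 : ℝ) < m := by exact_mod_cast hm
  have hx0 : 0 < x := hs.trans hsx
  have hx1 : 0 < 1 - x := by
    rw [hx, sub_pos, div_lt_one (by positivity)]; linarith
  have hs1 : 0 < 1 - s := by linarith
  rw [← Real.log_lt_log_iff (by positivity) (by positivity),
    Real.log_mul (by positivity) (by positivity), Real.log_mul (by positivity) (by positivity),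
    Real.log_pow, Real.log_pow, Real.log_rpow hs1, Real.log_rpow hx1]
  have h1 := Real.log_lt_sub_one_of_pos (div_pos hs hx0)
    (by rw [Ne, div_eq_one_iff_eq hx0.ne']; exact hsx.ne)
  have h2 := Real.log_le_sub_one_of_pos (div_pos hs1 hx1)
  rw [Real.log_div hs.ne' hx0.ne'] at h1
  rw [Real.log_div hs1.ne' hx1.ne'] at h2
  have h3 : m * (s / x - 1) + β * ((1 - s) / (1 - x) - 1) = 0 := by
    have hmx : (m : ℝ) * (1 - x) = β * x := by rw [hx]; field_simp; ring
    field_simp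
    linear_combination (s - x) * hmx
  nlinarith [mul_lt_mul_of_pos_left h1 hm', mul_le_mul_of_nonneg_left h2 hβ.le]

lemma one_sub_conj_mul_re_pos {w z : ℂ} (hw : w ∈ disk) (hz : z ∈ disk) :
    0 < (1 - (starRingEnd ℂ) w * z).re := by
  have hw1 : ‖w‖ < 1 := by simpa [disk] using hw
  have hz1 : ‖z‖ < 1 := by simpa [disk] using hz
  have h := Complex.re_le_norm ((starRingEnd ℂ) w * z)
  rw [norm_mul, Complex.norm_conj] at h
  rw [Complex.sub_re, Complex.one_re]
  nlinarith [norm_nonneg w, norm_nonneg z]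

lemma one_sub_conj_mul_ne_zero {w z : ℂ} (hw : w ∈ disk) (hz : z ∈ disk) :
    1 - (starRingEnd ℂ) w * z ≠ 0 := fun h ↦ by
  simpa [h] using one_sub_conj_mul_re_pos hw hz

lemma one_sub_norm_mobius_sq {w z : ℂ} (hw : w ∈ disk) (hz : z ∈ disk) :
    1 - ‖mobius w z‖ ^ 2 =
      (1 - ‖w‖ ^ 2) * (1 - ‖z‖ ^ 2) / ‖1 - (starRingEnd ℂ) w * z‖ ^ 2 := by
  have h0 : ‖1 - (starRingEnd ℂ) w * z‖ ^ 2 ≠ 0 := by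
    simpa using one_sub_conj_mul_ne_zero hw hz
  rw [mobius, norm_div, div_pow, eq_div_iff h0, sub_mul, div_mul_cancel₀ _ h0]
  simp only [Complex.sq_norm, Complex.normSq_apply, Complex.sub_re, Complex.sub_im,
    Complex.mul_re, Complex.mul_im, Complex.conj_re, Complex.conj_im, Complex.one_re,
    Complex.one_im]
  ring

lemma mobius_mem_disk {w z : ℂ} (hw : w ∈ disk) (hz : z ∈ disk) : mobius w z ∈ disk := by
  have h := one_sub_norm_mobius_sq hw hz
  have h0 : 0 < ‖1 - (starRingEnd ℂ) w * z‖ := by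
    simpa using one_sub_conj_mul_ne_zero hw hz
  have h1 : 0 < 1 - ‖mobius w z‖ ^ 2 := by
    rw [h]
    have := one_sub_norm_sq_pos hw
    have := one_sub_norm_sq_pos hz
    positivity
  rw [disk, mem_ball_zero_iff]
  nlinarith [norm_nonneg (mobius w z)]

lemma mobius_sub_self {w z : ℂ} (hw : w ∈ disk) (hz : z ∈ disk) :
    mobius w z - w = z * (-(1 - ‖w‖ ^ 2) / (1 - (starRingEnd ℂ) w * z)) := by
  have h0 := one_sub_conj_mul_ne_zero hw hz
  rw [mobius, ← Complex.conj_mul', mul_div_assoc', eq_div_iff h0, sub_mul, div_mul_cancel₀ _ h0]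
  ring

lemma mobius_mobius {w z : ℂ} (hw : w ∈ disk) (hz : z ∈ disk) : mobius w (mobius w z) = z := by
  have h0 := one_sub_conj_mul_ne_zero hw hz
  have h1 := one_sub_conj_mul_ne_zero hw (mobius_mem_disk hw hz)
  have hw1 : (1 : ℂ) - (starRingEnd ℂ) w * w ≠ 0 := one_sub_conj_mul_ne_zero hw hw
  rw [mobius, div_eq_iff h1, mobius, ← mul_left_inj' h0, sub_mul, div_mul_cancel₀ _ h0, mul_assoc,
    sub_mul, mul_assoc _ (_ / _), div_mul_cancel₀ _ h0]
  ring

lemma differentiableOn_mobius {w : ℂ} (hw : w ∈ disk) : DifferentiableOn ℂ (mobius w) disk :=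
  DifferentiableOn.div (by fun_prop) (by fun_prop) fun _ hz ↦ one_sub_conj_mul_ne_zero hw hz

/-- If `h` is divisible by `(z - w) ^ m`, then `‖h z‖² (1 - ‖z‖²) ^ β` cannot attain a nonzero
maximum over the unit disk at a point of `D(w, √(m / (m + β)))`. -/
theorem eq_zero_of_isMaxOn_of_mem_pseudoDisk {h g : ℂ → ℂ} {w z₀ : ℂ} {m : ℕ} {β : ℝ}
    (hw : w ∈ disk) (hm : 0 < m) (hβ : 0 < β) (hg : DifferentiableOn ℂ g disk)
    (hfac : ∀ z ∈ disk, h z = (z - w) ^ m * g z)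
    (hz₀ : z₀ ∈ pseudoDisk w (Real.sqrt (m / (m + β))))
    (hmax : IsMaxOn (fun z ↦ ‖h z‖ ^ 2 * (1 - ‖z‖ ^ 2) ^ β) disk z₀) : h z₀ = 0 := by
  obtain ⟨hz₀d, hlt⟩ := hz₀
  by_contra hne
  set x : ℝ := m / (m + β) with hx
  have hm' : (0 : ℝ) < m := by exact_mod_cast hm
  have hx0 : 0 < x := by positivity
  have hx1 : x < 1 := by rw [hx, div_lt_one (by positivity)]; linarith
  have hr0 : 0 < Real.sqrt x := Real.sqrt_pos.2 hx0
  have hr1 : Real.sqrt x < 1 := by rw [Real.sqrt_lt' one_pos]; simpa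
  set ζ₀ := mobius w z₀ with hζ₀
  have hζ₀d : ζ₀ ∈ disk := mobius_mem_disk hw hz₀d
  have hζ₀m : mobius w ζ₀ = z₀ := mobius_mobius hw hz₀d
  have hζ₀r : ‖ζ₀‖ < Real.sqrt x := hlt
  set b : ℂ → ℂ := fun ζ ↦ 1 - (starRingEnd ℂ) w * ζ with hb
  have hb0 : ∀ ζ ∈ disk, b ζ ≠ 0 := fun ζ hζ ↦ one_sub_conj_mul_ne_zero hw hζ
  -- The power b^(-β) absorbs the denominator of (1 - |φ_w|²)^β; its principal branch is holomorphic
  -- because Re b > 0.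
  set G : ℂ → ℂ := fun ζ ↦
    (-(1 - ‖w‖ ^ 2) / b ζ) ^ m * g (mobius w ζ) * b ζ ^ (-β : ℂ) with hG
  have hbd : DifferentiableOn ℂ b disk := by fun_prop
  have hGd : DifferentiableOn ℂ G disk := by
    refine ((((differentiableOn_const _).div hbd hb0).pow m).mul
      (hg.comp (differentiableOn_mobius hw) fun ζ hζ ↦ mobius_mem_disk hw hζ)).mul
      (hbd.cpow_const fun ζ hζ ↦ ?_)
    exact Or.inl (one_sub_conj_mul_re_pos hw hζ)
  have hcw := one_sub_norm_sq_pos hw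
  have hV : ∀ ζ ∈ disk, ‖h (mobius w ζ)‖ ^ 2 * (1 - ‖mobius w ζ‖ ^ 2) ^ β =
      (1 - ‖w‖ ^ 2) ^ β * (‖G ζ‖ ^ 2 * ((‖ζ‖ ^ 2) ^ m * (1 - ‖ζ‖ ^ 2) ^ β)) := fun ζ hζ ↦ by
    have hbn : 0 < ‖b ζ‖ := norm_pos_iff.2 (hb0 ζ hζ)
    have hcz := one_sub_norm_sq_pos hζ
    have hG2 : ‖G ζ‖ = ‖(-(1 - ‖w‖ ^ 2) / b ζ) ^ m * g (mobius w ζ)‖ * ‖b ζ‖ ^ (-β) := by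
      rw [hG, norm_mul]
      congr 1
      have := Complex.norm_cpow_real (b ζ) (-β)
      simpa using this
    have hh : ‖h (mobius w ζ)‖ = ‖ζ‖ ^ m * ‖(-(1 - ‖w‖ ^ 2) / b ζ) ^ m * g (mobius w ζ)‖ := by
      rw [hfac _ (mobius_mem_disk hw hζ), mobius_sub_self hw hζ, mul_pow, mul_assoc, norm_mul,
        norm_pow]
    rw [hh, hG2, one_sub_norm_mobius_sq hw hζ, Real.div_rpow (by positivity) (by positivity),
      Real.mul_rpow hcw.le hcz.le, Real.rpow_neg hbn.le]
    have h2 : (‖1 - (starRingEnd ℂ) w * ζ‖ ^ 2) ^ β = (‖b ζ‖ ^ β) ^ 2 := by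
      rw [← Real.rpow_natCast, ← Real.rpow_natCast, ← Real.rpow_mul hbn.le,
        ← Real.rpow_mul hbn.le, mul_comm]
    rw [h2, pow_right_comm ‖ζ‖ 2 m]
    field_simp
  have hle : ∀ ζ ∈ disk, ‖G ζ‖ ^ 2 * ((‖ζ‖ ^ 2) ^ m * (1 - ‖ζ‖ ^ 2) ^ β) ≤
      ‖G ζ₀‖ ^ 2 * ((‖ζ₀‖ ^ 2) ^ m * (1 - ‖ζ₀‖ ^ 2) ^ β) := fun ζ hζ ↦ by
    have := hmax (mobius_mem_disk hw hζ)
    simp only [mem_ofPred_eq] at this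
    rw [hV ζ hζ, ← hζ₀m, hV ζ₀ hζ₀d] at this
    exact le_of_mul_le_mul_left this (by positivity)
  have hζ₀0 : ζ₀ ≠ 0 := fun h0 ↦ hne <| by
    have : z₀ = w := by rw [← hζ₀m, h0]; simp [mobius]
    rw [hfac z₀ hz₀d, this, sub_self, zero_pow hm.ne', zero_mul]
  have hG0 : G ζ₀ ≠ 0 := fun h0 ↦ hne <| by
    have := hV ζ₀ hζ₀d
    rw [hζ₀m, h0] at this
    have hp := Real.rpow_pos_of_pos (one_sub_norm_sq_pos hz₀d) β
    simpa [hp.ne'] using this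
  have hs : 0 < ‖ζ₀‖ ^ 2 := by positivity
  have hsx : ‖ζ₀‖ ^ 2 < x := by rwa [← Real.lt_sqrt (norm_nonneg _)]
  set q : ℝ := (‖ζ₀‖ ^ 2) ^ m * (1 - ‖ζ₀‖ ^ 2) ^ β with hq
  set Q : ℝ := x ^ m * (1 - x) ^ β with hQ
  have hqQ : q < Q := pow_mul_rpow_lt hm hβ hs hx hsx
  have hq0 : 0 < q := by
    have := one_sub_norm_sq_pos hζ₀d
    positivity
  have hQ0 : 0 < Q := hq0.trans hqQ
  -- Maximality bounds |G|² by |G ζ₀|² q / Q on the circle |ζ|² = x; the maximum principle carries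
  -- this to ζ₀, where q < Q contradicts it.
  have hbound : ‖G ζ₀‖ ≤ Real.sqrt (‖G ζ₀‖ ^ 2 * q / Q) := by
    refine Complex.norm_le_of_forall_mem_frontier_norm_le (U := ball 0 (Real.sqrt x)) isBounded_ball
      ((hGd.mono (closedBall_subset_ball hr1)).diffContOnCl_ball subset_rfl) (fun ζ hζ ↦ ?_)
      (subset_closure (by simpa using hζ₀r))
    rw [frontier_ball _ hr0.ne', mem_sphere_zero_iff_norm] at hζ
    have := hle ζ (by rw [disk, mem_ball_zero_iff, hζ]; exact hr1)
    rw [hζ, Real.sq_sqrt hx0.le] at this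
    refine Real.le_sqrt_of_sq_le ?_
    rwa [le_div_iff₀ hQ0]
  have h1 := Real.le_sqrt' (norm_pos_iff.2 hG0) |>.1 hbound
  rw [le_div_iff₀ hQ0] at h1
  have h2 : 0 < ‖G ζ₀‖ ^ 2 := by positivity
  nlinarith [mul_lt_mul_of_pos_left hqQ h2]

/-! ### Existence of a maximum -/

/-- The weight is at most C(1 - |z|²)^ε, hence below its value at z₁ near the boundary, so a maximum
over a compact disk containing z₁ is global. -/
lemma exists_isMaxOn_disk {h : ℂ → ℂ} {γ ε C : ℝ} (hε : 0 < ε) (hh : DifferentiableOn ℂ h disk)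
    (hC : ∀ z ∈ disk, ‖h z‖ ^ 2 * (1 - ‖z‖ ^ 2) ^ γ ≤ C) {z₁ : ℂ} (hz₁ : z₁ ∈ disk)
    (hne : h z₁ ≠ 0) :
    ∃ z₀ ∈ disk, IsMaxOn (fun z ↦ ‖h z‖ ^ 2 * (1 - ‖z‖ ^ 2) ^ (γ + ε)) disk z₀ := by
  set V : ℂ → ℝ := fun z ↦ ‖h z‖ ^ 2 * (1 - ‖z‖ ^ 2) ^ (γ + ε) with hVdef
  have hV1 : 0 < V z₁ := mul_pos (by positivity) (Real.rpow_pos_of_pos (one_sub_norm_sq_pos hz₁) _)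
  have hVle : ∀ z ∈ disk, V z ≤ C * (1 - ‖z‖ ^ 2) ^ ε := fun z hz ↦ by
    have hp := one_sub_norm_sq_pos hz
    simp only [hVdef]
    rw [Real.rpow_add hp, ← mul_assoc]
    exact mul_le_mul_of_nonneg_right (hC z hz) (Real.rpow_nonneg hp.le _)
  have hlim : Tendsto (fun t : ℝ ↦ C * (1 - t ^ 2) ^ ε) (𝓝[<] 1) (𝓝 0) := by
    have : ContinuousAt (fun t : ℝ ↦ C * (1 - t ^ 2) ^ ε) 1 :=
      continuousAt_const.mul ((by fun_prop : ContinuousAt (fun t : ℝ ↦ 1 - t ^ 2) 1).rpow_const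
        (Or.inr hε.le))
    have h2 := this.tendsto
    simp only [one_pow, sub_self, Real.zero_rpow hε.ne', mul_zero] at h2
    exact h2.mono_left nhdsWithin_le_nhds
  obtain ⟨R, hR1, hR⟩ := (mem_nhdsLT_iff_exists_Ioo_subset' (zero_lt_one' ℝ)).1
    (hlim.eventually_lt_const hV1)
  have hR1' : R < 1 := hR1
  set S := max R ‖z₁‖ with hS
  have hz₁1 : ‖z₁‖ < 1 := by simpa [disk] using hz₁
  have hS1 : S < 1 := max_lt hR1' hz₁1
  have hSd : closedBall (0 : ℂ) S ⊆ disk := closedBall_subset_ball hS1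
  have hz₁S : z₁ ∈ closedBall (0 : ℂ) S := by simp [hS]
  have hVc : ContinuousOn V (closedBall 0 S) := by
    refine ((hh.continuousOn.mono hSd).norm.pow 2).mul
      (ContinuousOn.rpow_const (by fun_prop) fun z hz ↦ Or.inl ?_)
    exact (one_sub_norm_sq_pos (hSd hz)).ne'
  obtain ⟨z₀, hz₀, hmax⟩ := (isCompact_closedBall (0 : ℂ) S).exists_isMaxOn ⟨z₁, hz₁S⟩ hVc
  refine ⟨z₀, hSd hz₀, fun z hz ↦ ?_⟩
  by_cases hzS : z ∈ closedBall (0 : ℂ) S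
  · exact hmax hzS
  · have hzS' : S < ‖z‖ := by simpa using hzS
    have hz1 : ‖z‖ < 1 := by simpa [disk] using hz
    have h1 : C * (1 - ‖z‖ ^ 2) ^ ε < V z₁ :=
      hR ⟨(le_max_left _ _).trans_lt hzS', hz1⟩
    exact (hVle z hz).trans (h1.le.trans (hmax hz₁S))

/-! ### The uniqueness theorem -/

theorem isUniquenessDivisor_bergman {α ε : ℝ} (hα : 0 < α) (hε : 0 < ε) (X : Divisor)
    {K : Set ℂ} (hK : IsCompact K) (hKdisk : K ⊆ disk)
    (hcover : (⋃ w : X.points, pseudoDisk (w : ℂ)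
        (Real.sqrt ((X.mult w : ℝ) / ((X.mult w : ℝ) + α + 2 + ε))))
      = disk \ K) :
    IsUniquenessDivisor X (bergman α) := by
  intro f hf hvan z hz
  by_contra hfz
  obtain ⟨C, hC⟩ := exists_sq_norm_mul_rpow_le_of_mem_bergman hα hf
  have hfd : DifferentiableOn ℂ f disk := hf.1
  have hz1 : ‖z‖ < 1 := by simpa [disk] using hz
  obtain ⟨ρ₀, hρ₀0, hρ₀1, hKρ⟩ : ∃ ρ₀ : ℝ, 0 < ρ₀ ∧ ρ₀ < 1 ∧ K ⊆ ball 0 ρ₀ := by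
    obtain ⟨ρ₀, h, hsub⟩ := exists_pos_lt_subset_ball one_pos hK.isClosed hKdisk
    exact ⟨ρ₀, h.1, h.2, hsub⟩
  obtain ⟨ρ, hρmax, hρ1⟩ := exists_between (max_lt hρ₀1 hz1)
  have hρ₀ρ : ρ₀ < ρ := (le_max_left _ _).trans_lt hρmax
  have hzρ : ‖z‖ < ρ := (le_max_right _ _).trans_lt hρmax
  have hρ0 : 0 < ρ := hρ₀0.trans hρ₀ρ
  -- If f vanished on the whole circle of radius ρ, the maximum principle would give f z = 0.
  obtain ⟨z₁, hz₁ρ, hfz₁⟩ : ∃ z₁ : ℂ, ‖z₁‖ = ρ ∧ f z₁ ≠ 0 := by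
    by_contra! hall
    refine hfz (norm_le_zero_iff.1 ?_)
    refine Complex.norm_le_of_forall_mem_frontier_norm_le (U := ball 0 ρ) isBounded_ball
      ((hfd.mono (closedBall_subset_ball hρ1)).diffContOnCl_ball subset_rfl) (fun ζ hζ ↦ ?_)
      (subset_closure (by simpa using hzρ))
    rw [frontier_ball _ hρ0.ne', mem_sphere_zero_iff_norm] at hζ
    simp [hall ζ hζ]
  have hz₁ : z₁ ∈ disk := by rw [disk, mem_ball_zero_iff, hz₁ρ]; exact hρ1
  have hC0 : 0 ≤ C := (mul_nonneg (sq_nonneg _)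
    (Real.rpow_nonneg (one_sub_norm_sq_pos hz).le _)).trans (hC z hz)
  have hfle : ∀ y ∈ disk, ‖f y‖ ^ 2 * (1 - ‖y‖ ^ 2) ^ (α + 2 + ε) ≤ C := fun y hy ↦ by
    refine le_trans ?_ (hC y hy)
    gcongr ?_ * ?_
    exact Real.rpow_le_rpow_of_exponent_ge (one_sub_norm_sq_pos hy)
      (by nlinarith [norm_nonneg y]) (by linarith)
  set v := ‖f z₁‖ ^ 2 * (1 - ‖z₁‖ ^ 2) ^ (α + 2 + ε) with hv
  have hv0 : 0 < v :=
    mul_pos (by positivity) (Real.rpow_pos_of_pos (one_sub_norm_sq_pos hz₁) _)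
  -- As |z₁| = ρ > ρ₀, this N makes the weight of y^N f at z₁ exceed its values on K.
  obtain ⟨N, hN⟩ : ∃ N : ℕ, C * ((ρ₀ / ρ) ^ 2) ^ N < v := by
    have hlim := (tendsto_pow_atTop_nhds_zero_of_lt_one (r := (ρ₀ / ρ) ^ 2) (by positivity)
      (pow_lt_one₀ (by positivity) ((div_lt_one hρ0).2 hρ₀ρ) two_ne_zero)).const_mul C
    rw [mul_zero] at hlim
    exact (hlim.eventually_lt_const hv0).exists
  set h : ℂ → ℂ := fun y ↦ y ^ N * f y with hh
  have hhd : DifferentiableOn ℂ h disk := (differentiableOn_id.pow N).mul hfd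
  have hhV : ∀ (y : ℂ) (γ : ℝ), ‖h y‖ ^ 2 * (1 - ‖y‖ ^ 2) ^ γ =
      (‖y‖ ^ 2) ^ N * (‖f y‖ ^ 2 * (1 - ‖y‖ ^ 2) ^ γ) := fun y γ ↦ by
    simp only [hh, norm_mul, norm_pow]
    ring
  have hhC : ∀ y ∈ disk, ‖h y‖ ^ 2 * (1 - ‖y‖ ^ 2) ^ (α + 2) ≤ C := fun y hy ↦ by
    rw [hhV]
    have h1 := one_sub_norm_sq_pos hy
    exact (mul_le_of_le_one_left (by positivity)
      (pow_le_one₀ (by positivity) (by linarith))).trans (hC y hy)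
  have hhz₁ : h z₁ ≠ 0 := mul_ne_zero (pow_ne_zero _ (norm_pos_iff.1 (hz₁ρ ▸ hρ0))) hfz₁
  obtain ⟨z₀, hz₀, hmax⟩ := exists_isMaxOn_disk hε hhd hhC hz₁ hhz₁
  have hz₀z₁ := hmax hz₁
  simp only [mem_ofPred_eq] at hz₀z₁
  rw [hhV z₁, ← hv, hhV z₀] at hz₀z₁
  have hz₀K : z₀ ∉ K := fun hmem ↦ by
    have hlt : ‖z₀‖ < ρ₀ := by simpa using hKρ hmem
    have h1 : (ρ ^ 2) ^ N * v ≤ (ρ₀ ^ 2) ^ N * C := by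
      rw [hz₁ρ] at hz₀z₁
      refine hz₀z₁.trans ?_
      have := one_sub_norm_sq_pos hz₀
      gcongr
      exact hfle z₀ hz₀
    rw [div_pow, div_pow, mul_div_assoc', div_lt_iff₀ (by positivity)] at hN
    linarith
  have hz₀c : z₀ ∈ disk \ K := ⟨hz₀, hz₀K⟩
  rw [← hcover] at hz₀c
  obtain ⟨w, hw⟩ := mem_iUnion.1 hz₀c
  have hwd : (w : ℂ) ∈ disk := X.points_subset w.2
  obtain ⟨g, hg, hfac⟩ := exists_eq_pow_mul_of_iteratedDeriv_eq_zero isOpen_ball hfd hwd (hvan w)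
  have hz₀0 : h z₀ = 0 := by
    -- The factor y^N goes into the cofactor, so the multiplicity used at w stays m even if w = 0.
    refine eq_zero_of_isMaxOn_of_mem_pseudoDisk (g := fun y ↦ y ^ N * g y) hwd (X.mult_pos w)
      (by positivity : 0 < α + 2 + ε) ((differentiableOn_id.pow N).mul hg) (fun y hy ↦ ?_) ?_ hmax
    · simp only [hh, hfac y hy]
      ring
    · simpa only [add_assoc] using hw
  have h2 : 0 < (‖z₁‖ ^ 2) ^ N * v := by
    have : 0 < ‖z₁‖ := hz₁ρ ▸ hρ0
    positivity
  rw [← hhV z₀, hz₀0] at hz₀z₁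
  norm_num at hz₀z₁
  linarith

end BergmanDivisor

theorem theorem1p3 (α ε : ℝ) (hα : 0 < α) (hε : 0 < ε) (X : BergmanDivisor.Divisor)
    (K : Set ℂ) (hK : IsCompact K) (hKdisk : K ⊆ BergmanDivisor.disk)
    (hcover : (⋃ w : X.points, BergmanDivisor.pseudoDisk (w : ℂ)
        (Real.sqrt ((X.mult w : ℝ) / ((X.mult w : ℝ) + α + 2 + ε))))
      = BergmanDivisor.disk \ K) :
    BergmanDivisor.IsUniquenessDivisor X (BergmanDivisor.bergman α) :=
  BergmanDivisor.isUniquenessDivisor_bergman hα hε X hK hKdisk hcover
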